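/- For a nonzero homogeneous polynomial $F$ on a complex vector space of dimension $m+1$, consider the hypersurface $Y=\{F=0\}\subset\mathbb P^m$ defined by $F$. Let $\phi:\mathbb P^m\dashrightarrow\mathbb P^{m\,*}$ be its polar map, given by the partial derivatives of $F$ and defined at the points where these do not all vanish, and let $Z\subset\mathbb P^{m\,*}$ be the Zariski closure of the image of $\phi$. The polar defect of $Y$ is $\operatorname{pdef} Y=\operatorname{codim} Z=m-\dim Z$, and $Y$ is called polar defective if $Z\neq\mathbb P^{m\,*}$ (equivalently, $\operatorname{pdef}Y>0$). Let $Y\subset\mathbb P^N$ be an irreducible complex projective hypersurface defined by an irreducible homogeneous polynomial $F$ of degree $d>1$. Let $L\subset\mathbb P^N$ be a general hyperplane (that is, let $L$ belong to a suitable nonempty Zariski open subset of $\mathbb P^{N\,*}$ depending on $Y$), and let $Y_L=L\cap Y$ be the corresponding hyperplane section, regarded as the hypersurface in $L\cong\mathbb P^{N-1}$ defined by the restriction $F|_L$. Then either $\operatorname{pdef} Y=\operatorname{pdef} Y_L=0$ or $\operatorname{pdef} Y=\operatorname{pdef} Y_L+1$. In particular, if $Y_L$ is polar defective, then so is $Y$.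 -/

import Mathlib

open scoped LinearAlgebra.Projectivization

noncomputable section

namespace PolarDefect

/-- The affine cone in `ℂⁿ` over a subset of the projective space `ℙⁿ⁻¹`
(the origin is always included). -/
def affineCone {n : ℕ} (S : Set (ℙ ℂ (Fin n → ℂ))) : Set (Fin n → ℂ) :=
  {v | ∀ hv : v ≠ 0, Projectivization.mk ℂ v hv ∈ S}

/-- The homogeneous ideal of a subset of projective space: all polynomials vanishing on
the affine cone over it. -/
def homogeneousIdeal {n : ℕ} (S : Set (ℙ ℂ (Fin n → ℂ))) : Ideal (MvPolynomial (Fin n) ℂ) :=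
  MvPolynomial.vanishingIdeal ℂ (affineCone S)

/-- The Zariski closure of a subset of projective space. -/
def zariskiClosure {n : ℕ} (S : Set (ℙ ℂ (Fin n → ℂ))) : Set (ℙ ℂ (Fin n → ℂ)) :=
  {p | affineCone {p} ⊆ MvPolynomial.zeroLocus ℂ (homogeneousIdeal S)}

/-- A subset of projective space is Zariski open if its complement equals its Zariski closure. -/
def IsZariskiOpen {n : ℕ} (U : Set (ℙ ℂ (Fin n → ℂ))) : Prop :=
  zariskiClosure Uᶜ = Uᶜ

/-- The dimension of a subset of projective space: the Krull dimension of its homogeneous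
coordinate ring, minus one. The Krull dimension is a natural number here, since the coordinate ring
is a nonzero finitely generated algebra; the empty set has dimension `-1`. -/
def projDim {n : ℕ} (S : Set (ℙ ℂ (Fin n → ℂ))) : ℤ :=
  (((ringKrullDim (MvPolynomial (Fin n) ℂ ⧸ homogeneousIdeal S)).unbotD 0).toNat : ℤ) - 1

/-- The vector of partial derivatives of `F` at `v`. It is read in the coordinates of the dual
space, where `a` stands for the linear form `x ↦ ∑ i, a i * x i`. -/
def grad {n : ℕ} (F : MvPolynomial (Fin n) ℂ) (v : Fin n → ℂ) : Fin n → ℂ :=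
  fun i => MvPolynomial.eval v (MvPolynomial.pderiv i F)

/-- The image `Z` of the polar map `ℙⁿ⁻¹ ⇢ (ℙⁿ⁻¹)*` of the form `F`, `[v] ↦ [grad F v]`: the Zariski
closure of the set of its values, taken at the points where some partial derivative is nonzero. -/
def polarImage {n : ℕ} (F : MvPolynomial (Fin n) ℂ) : Set (ℙ ℂ (Fin n → ℂ)) :=
  zariskiClosure
    {z | ∃ v : Fin n → ℂ, v ≠ 0 ∧ ∃ h : grad F v ≠ 0, z = Projectivization.mk ℂ (grad F v) h}

/-- The hypersurface `F = 0` is polar defective if the image of the polar map is not the whole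
dual projective space. -/
def IsPolarDefective {n : ℕ} (F : MvPolynomial (Fin n) ℂ) : Prop :=
  polarImage F ≠ Set.univ

/-- The polar defect of the hypersurface `F = 0` in `ℙⁿ⁻¹`: the codimension of the image of the
polar map in the dual projective space. -/
def pdef {n : ℕ} (F : MvPolynomial (Fin n) ℂ) : ℤ :=
  ((n : ℤ) - 1) - projDim (polarImage F)

/-- The linear hyperplane `{v | ∑ i, a i * v i = 0}` corresponding to a point `[a]` of the dual
projective space. -/
def hyperplane {n : ℕ} (L : ℙ ℂ (Fin n → ℂ)) : Submodule ℂ (Fin n → ℂ) where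
  carrier := {v | L.rep ⬝ᵥ v = 0}
  add_mem' := by
    intro v w hv hw
    simp only [Set.mem_ofPred_eq] at hv hw ⊢
    rw [dotProduct_add, hv, hw, add_zero]
  zero_mem' := by simp
  smul_mem' := by
    intro c v hv
    simp only [Set.mem_ofPred_eq] at hv ⊢
    rw [dotProduct_smul, hv, smul_zero]

/-- The restriction of a form `F` to a linear subspace `W`, written as a polynomial in the linear
coordinates on `W` given by `e`; that is, the polynomial function `t ↦ F (e t)`. -/
def restrict {m n : ℕ} (F : MvPolynomial (Fin n) ℂ) {W : Submodule ℂ (Fin n → ℂ)}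
    (e : (Fin m → ℂ) ≃ₗ[ℂ] W) : MvPolynomial (Fin m) ℂ :=
  MvPolynomial.bind₁
    (fun i => ∑ j, MvPolynomial.C ((e (Pi.single j 1) : Fin n → ℂ) i) * MvPolynomial.X j) F

end PolarDefect

end

noncomputable section

open MvPolynomial

/-! The ideal of the polar image consists of the polynomial relations among the partial derivatives
of `F`, so the dimension of its cone is the transcendence degree of the algebra they generate. In
characteristic zero the Jacobian criterion identifies this degree with the generic rank r of the
Hessian, so the polar defect is the number of variables minus r (`pdef_eq`).

Restriction to a hyperplane restricts the Hessian as a quadratic form, so its generic rank is at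
most min(r, N) (`polarRank_restrict_le`). Equality holds for general L. Take x with F(x) ≠ 0 at
which the Hessian has rank r. By Euler's formula x is anisotropic for it, so x extends to an
orthogonal basis. The span of all basis vectors but one, suitably chosen and different from x, is a
hyperplane through x on which the form has rank at least min(r, N)
(`Matrix.IsSymm.exists_hyperplane`). A nonvanishing Gram determinant spreads this bound to an open
set of hyperplanes. The claim follows by comparing N + 1 - r with N - min(r, N), where r ≤ N + 1. -/

/-! ### Krull dimension and transcendence degree -/

/-- Incomparability gives one inequality, lying over and going up the other. -/
theorem ringKrullDim_eq_of_isIntegral {R S : Type*} [CommRing R] [CommRing S] [Algebra R S]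
    [Algebra.IsIntegral R S] [FaithfulSMul R S] : ringKrullDim S = ringKrullDim R := by
  apply le_antisymm
  · refine Order.krullDim_le_of_strictMono (PrimeSpectrum.comap (algebraMap R S)) fun p q hpq => ?_
    exact Ideal.IsIntegral.comap_lt_comap (R := R) (I := p.asIdeal) (J := q.asIdeal) hpq
  · refine iSup_le fun l => ?_
    obtain ⟨P, hP⟩ := Algebra.IsIntegral.comap_surjective R S l.head
    have : P.asIdeal.LiesOver l.head.asIdeal := ⟨by rw [← hP]; rfl⟩
    obtain ⟨L, hL, -⟩ := Ideal.exists_ltSeries_of_hasGoingUp l P.asIdeal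
    rw [← hL]
    exact Order.LTSeries.length_le_krullDim L

/-- By Noether normalization both sides equal the number of variables of a polynomial ring over
which `A` is integral. -/
theorem ringKrullDim_eq_trdeg (k A : Type) [Field k] [CommRing A] [IsDomain A] [Algebra k A]
    [Algebra.FiniteType k A] :
    ringKrullDim A = (Cardinal.toNat (Algebra.trdeg k A) : ℕ) := by
  obtain ⟨s, g, hg, hint⟩ := exists_integral_inj_algHom_of_fg k A
  algebraize [g.toRingHom]
  have : FaithfulSMul (MvPolynomial (Fin s) k) A := (faithfulSMul_iff_algebraMap_injective _ _).2 hg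
  have : IsScalarTower k (MvPolynomial (Fin s) k) A :=
    IsScalarTower.of_algebraMap_eq fun x => (g.commutes x).symm
  rw [ringKrullDim_eq_of_isIntegral (R := MvPolynomial (Fin s) k),
    MvPolynomial.ringKrullDim_of_isNoetherianRing,
    ← trdeg_add_eq k (MvPolynomial (Fin s) k) (A := A)]
  simp [ringKrullDim_eq_zero_of_field, trdeg_eq_zero]

/-! ### The Jacobian criterion in characteristic zero -/

theorem Matrix.exists_mul_eq_one_of_linearIndependent_row {K ι κ : Type*} [Field K] [Fintype ι]
    [DecidableEq ι] [Fintype κ] [DecidableEq κ] {M : Matrix ι κ K}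
    (h : LinearIndependent K M.row) : ∃ B : Matrix κ ι K, M * B = 1 := by
  obtain ⟨g, hg⟩ := LinearMap.exists_leftInverse_of_injective (Matrix.vecMulLinear M)
    (LinearMap.ker_eq_bot.2 (Matrix.vecMul_injective_iff.2 h))
  refine ⟨Matrix.of fun l j => g (Pi.single l 1) j, ?_⟩
  ext i j
  have h1 := congrFun (LinearMap.congr_fun hg (Pi.single i 1)) j
  have h2 : Matrix.vecMulLinear M (Pi.single i 1) = ∑ l, M i l • Pi.single l (1 : K) := by
    ext l
    simp [Pi.single_apply]
  rw [LinearMap.comp_apply, h2, map_sum] at h1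
  simpa [Matrix.mul_apply, Matrix.one_apply, Pi.single_apply, eq_comm] using h1

namespace MvPolynomial

variable {K : Type} [Field K] {σ : Type} {ι : Type}

theorem pderiv_aeval [Fintype ι] (g : ι → MvPolynomial σ K) (P : MvPolynomial ι K) (j : σ) :
    pderiv j (aeval g P) = ∑ a, aeval g (pderiv a P) * pderiv j (g a) := by
  classical
  induction P using MvPolynomial.induction_on with
  | C c => simp [algebraMap_eq]
  | add p q hp hq => simp only [map_add, hp, hq, add_mul, Finset.sum_add_distrib]
  | mul_X p i hp =>
    simp only [map_mul, aeval_X, pderiv_mul, hp, map_add, pderiv_X, add_mul,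
      Finset.sum_add_distrib, Finset.sum_mul]
    congr 1
    · exact Finset.sum_congr rfl fun _ _ => by ring
    · rw [Finset.sum_eq_single i]
      · simp
      · intro b _ hb; simp [hb.symm]
      · simp

theorem totalDegree_pderiv_le (P : MvPolynomial ι K) (a : ι) :
    (pderiv a P).totalDegree ≤ P.totalDegree - 1 := by
  refine Finset.sup_le fun m hm => ?_
  rw [mem_support_iff, coeff_pderiv] at hm
  have h := le_totalDegree (mem_support_iff.2 (left_ne_zero_of_mul hm))
  rw [Finsupp.sum_add_index' (fun _ => rfl) (fun _ _ _ => rfl),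
    Finsupp.sum_single_index rfl] at h
  omega

theorem totalDegree_eq_zero_of_pderiv_eq_zero [CharZero K] {P : MvPolynomial ι K}
    (h : ∀ a, pderiv a P = 0) : P.totalDegree = 0 := by
  refine (totalDegree_eq_zero_iff _ _).2 fun m hm a => ?_
  by_contra hma
  have hle : Finsupp.single a 1 ≤ m := by
    rw [Finsupp.single_le_iff]; omega
  have h1 := coeff_pderiv (i := a) P (m - Finsupp.single a 1)
  rw [h a, coeff_zero, tsub_add_cancel_of_le hle] at h1
  rcases mul_eq_zero.1 h1.symm with h2 | h2
  · exact mem_support_iff.1 hm h2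
  · exact Nat.cast_add_one_ne_zero _ h2

/-- The Jacobian matrix at the point `x` of a family of polynomials. -/
def jacobianAt (f : ι → MvPolynomial σ K) (x : σ → K) : Matrix ι σ K :=
  Matrix.of fun i j => eval x (pderiv j (f i))

/-- Differentiating a relation `P` among the `g a` gives, by the chain rule, a linear relation among
the Jacobian rows with coefficients the values of the partials of `P`. These rows are independent,
so the partials of `P` are relations of lower degree, zero by induction. Hence `P` is constant. -/
theorem algebraicIndependent_of_linearIndependent_jacobianAt [CharZero K] [Fintype ι] [Fintype σ]
    {g : ι → MvPolynomial σ K} {x : σ → K} (h : LinearIndependent K (jacobianAt g x).row) :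
    AlgebraicIndependent K g := by
  classical
  obtain ⟨B, hB⟩ := Matrix.exists_mul_eq_one_of_linearIndependent_row h
  let J₀ : Matrix ι σ (MvPolynomial σ K) := Matrix.of fun a j => pderiv j (g a)
  obtain ⟨J, hJ'⟩ : ∃ J : Matrix ι ι (MvPolynomial σ K),
    J = J₀ * B.map (C : K →+* MvPolynomial σ K) := ⟨_, rfl⟩
  -- `B` is a right inverse of the Jacobian at `x`, so this determinant takes the value 1 there.
  have hJ : J.det ≠ 0 := by
    intro h0
    have h1 : (eval x) J.det = 1 := by
      rw [RingHom.map_det]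
      have : (eval x).mapMatrix J = jacobianAt g x * B := by
        ext i j
        rw [RingHom.mapMatrix_apply, Matrix.map_apply, hJ', Matrix.mul_apply, Matrix.mul_apply]
        simp [J₀, jacobianAt]
      rw [this, hB, Matrix.det_one]
    rw [h0, map_zero] at h1
    exact zero_ne_one h1
  rw [algebraicIndependent_iff]
  suffices H : ∀ n, ∀ P : MvPolynomial ι K, P.totalDegree ≤ n → aeval g P = 0 → P = 0 from
    fun P => H _ P le_rfl
  intro n
  have const : ∀ P : MvPolynomial ι K, P.totalDegree = 0 → aeval g P = 0 → P = 0 := by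
    intro P hP hg
    rw [totalDegree_eq_zero_iff_eq_C] at hP
    rw [hP, aeval_C, algebraMap_eq, C_eq_zero] at hg
    rw [hP, hg, C_0]
  induction n with
  | zero => exact fun P hP => const P (Nat.le_zero.1 hP)
  | succ n ih =>
    intro P hP hg
    refine const P (totalDegree_eq_zero_of_pderiv_eq_zero fun a => ih _ ?_ ?_) hg
    · exact (totalDegree_pderiv_le P a).trans (by omega)
    · have h0 : Matrix.vecMul (fun a => aeval g (pderiv a P)) J₀ = 0 := by
        ext1 j
        have := pderiv_aeval g P j
        rw [hg, map_zero] at this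
        exact this.symm
      have h1 : Matrix.vecMul (fun a => aeval g (pderiv a P)) J = 0 := by
        rw [hJ', ← Matrix.vecMul_vecMul, h0, Matrix.zero_vecMul]
      exact congrFun (Matrix.eq_zero_of_vecMul_eq_zero hJ h1) a

end MvPolynomial

/-- Applying `D` to p(y) = 0 gives p'(y) · D y = 0. Either D y = 0, or p' is a nonzero relation of
lower degree. -/
theorem Derivation.eq_zero_of_isAlgebraic {S R M : Type*} [CommRing S] [IsDomain S] [CharZero S]
    [CommRing R] [IsDomain R] [Algebra S R] [FaithfulSMul S R] [Algebra.IsAlgebraic S R]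
    [AddCommGroup M] [Module R M] [Module S M] [IsScalarTower S R M] [Module.IsTorsionFree R M]
    (D : Derivation S R M) : D = 0 := by
  ext y
  suffices H : ∀ n, ∀ p : Polynomial S, p.natDegree ≤ n → p ≠ 0 → Polynomial.aeval y p = 0 →
      D y = 0 by
    obtain ⟨p, hp, hy⟩ := Algebra.IsAlgebraic.isAlgebraic (R := S) y
    exact H _ p le_rfl hp hy
  intro n
  have const : ∀ p : Polynomial S, p.natDegree = 0 → p ≠ 0 → Polynomial.aeval y p = 0 → False := by
    intro p hp h0 hy
    rw [Polynomial.eq_C_of_natDegree_eq_zero hp, Polynomial.aeval_C] at hy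
    apply h0
    rw [Polynomial.eq_C_of_natDegree_eq_zero hp,
      (map_eq_zero_iff _ (FaithfulSMul.algebraMap_injective S R)).1 hy, Polynomial.C_0]
  induction n with
  | zero => exact fun p hp h0 hy => (const p (Nat.le_zero.1 hp) h0 hy).elim
  | succ n ih =>
    intro p hp h0 hy
    have h1 := D.map_aeval p y
    rw [hy, map_zero] at h1
    rcases smul_eq_zero.1 h1.symm with h2 | h2
    · refine ih p.derivative ((Polynomial.natDegree_derivative_le p).trans (by omega)) ?_ h2
      intro h3
      exact const p (Polynomial.derivative_eq_zero.1 h3) h0 hy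
    · exact h2

/-- A derivation that vanishes on a set over which the ring is algebraic is zero. -/
theorem Derivation.eq_zero_of_isAlgebraic_adjoin {k R : Type*} [Field k] [CharZero k] [CommRing R]
    [IsDomain R] [Algebra k R] (u : Set R) [Algebra.IsAlgebraic (Algebra.adjoin k u) R]
    (D : Derivation k R R) (h : ∀ y ∈ u, D y = 0) : D = 0 := by
  have h0 : ∀ y ∈ Algebra.adjoin k u, D y = 0 :=
    Derivation.eqOn_adjoin (D1 := D) (D2 := 0) h
  let D' : Derivation (Algebra.adjoin k u) R R := Derivation.mk'
    { toFun := D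
      map_add' := map_add D
      map_smul' := fun s y => by
        simp [Algebra.smul_def, D.leibniz, h0 _ s.2] } D.leibniz
  have : CharZero (Algebra.adjoin k u) := charZero_of_injective_algebraMap
    (FaithfulSMul.algebraMap_injective k (Algebra.adjoin k u))
  have h2 := Derivation.eq_zero_of_isAlgebraic D'
  ext y
  exact Derivation.congr_fun h2 y

namespace MvPolynomial

variable {K : Type} [Field K] {σ : Type} {ι : Type}

/-- Extended to a transcendence basis, the family has a square Jacobian matrix, whose determinant
serves as `δ`. If it were zero, a null vector `w` would give the nonzero derivation ∑ `w j` ∂ⱼ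
killing the basis, which is impossible over an algebraic extension. -/
theorem exists_linearIndependent_jacobianAt_of_algebraicIndependent [CharZero K] [Fintype σ]
    {g : ι → MvPolynomial σ K} (hg : AlgebraicIndependent K g) :
    ∃ δ : MvPolynomial σ K, δ ≠ 0 ∧
      ∀ x, eval x δ ≠ 0 → LinearIndependent K (jacobianAt g x).row := by
  classical
  obtain ⟨u, hgu, hu⟩ := exists_isTranscendenceBasis_superset hg.to_subtype_range
  have hcard : Cardinal.mk u = Cardinal.mk σ := by
    rw [hu.cardinalMk_eq_trdeg, MvPolynomial.trdeg_of_isDomain, Cardinal.lift_id]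
  obtain ⟨e⟩ := Cardinal.eq.1 hcard
  have halg := hu.isAlgebraic
  rw [Subtype.range_coe] at halg
  let J : Matrix σ σ (MvPolynomial σ K) := Matrix.of fun a j => pderiv j (e.symm a : MvPolynomial σ K)
  refine ⟨J.det, ?_, fun x hx => ?_⟩
  · intro hdet
    obtain ⟨w, hw0, hw⟩ := Matrix.exists_mulVec_eq_zero_iff.2 hdet
    let D : Derivation K (MvPolynomial σ K) (MvPolynomial σ K) := ∑ j, w j • pderiv j
    have hD : ∀ y, D y = ∑ j, pderiv j y * w j := by
      intro y
      rw [← Derivation.coeFnAddMonoidHom_apply, map_sum, Finset.sum_apply]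
      exact Finset.sum_congr rfl fun j _ => by
        rw [Derivation.coeFnAddMonoidHom_apply, Derivation.smul_apply, smul_eq_mul, mul_comm]
    have h0 : D = 0 := Derivation.eq_zero_of_isAlgebraic_adjoin u D fun y hy => by
      have := congrFun hw (e ⟨y, hy⟩)
      rw [hD]
      simpa [J, Matrix.mulVec, dotProduct] using this
    apply hw0
    ext1 j
    have h1 := hD (X j)
    rw [h0] at h1
    simpa [pderiv_X, Pi.single_apply] using h1.symm
  · have h1 : LinearIndependent K ((eval x).mapMatrix J).row := by
      refine Matrix.linearIndependent_rows_of_det_ne_zero (A := (eval x).mapMatrix J) ?_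
      rwa [← RingHom.map_det]
    have h2 := h1.comp (fun i : ι => e ⟨g i, hgu ⟨i, rfl⟩⟩) fun i j hij =>
      hg.injective (by simpa using hij)
    convert h2 using 1
    ext i j
    simp [J, jacobianAt]

/-- The algebra generated by a family of polynomials. -/
abbrev generatedAlgebra (f : ι → MvPolynomial σ K) : Subalgebra K (MvPolynomial σ K) :=
  (aeval f : MvPolynomial ι K →ₐ[K] MvPolynomial σ K).range

/-- The transcendence degree of the algebra generated by a family of polynomials. -/
def algRank (f : ι → MvPolynomial σ K) : ℕ :=
  Cardinal.toNat (Algebra.trdeg K (generatedAlgebra f))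

theorem trdeg_generatedAlgebra [Finite σ] (f : ι → MvPolynomial σ K) :
    Algebra.trdeg K (generatedAlgebra f) = algRank f := by
  refine (Cardinal.cast_toNat_of_lt_aleph0 ?_).symm
  refine lt_of_le_of_lt (trdeg_le_of_injective (generatedAlgebra f).val
    Subtype.val_injective) ?_
  simp

/-- The generators of `generatedAlgebra f`. -/
def generator (f : ι → MvPolynomial σ K) (i : ι) : generatedAlgebra f :=
  ⟨f i, X i, by simp⟩

instance isAlgebraic_adjoin_range_generator (f : ι → MvPolynomial σ K) :
    Algebra.IsAlgebraic (Algebra.adjoin K (Set.range (generator f))) (generatedAlgebra f) := by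
  have hs : Algebra.adjoin K (Set.range (generator f)) = ⊤ := by
    apply Subalgebra.map_injective (f := (generatedAlgebra f).val) Subtype.val_injective
    rw [AlgHom.map_adjoin, Algebra.map_top, Subalgebra.range_val]
    change _ = (aeval f : MvPolynomial ι K →ₐ[K] MvPolynomial σ K).range
    rw [← Algebra.adjoin_range_eq_range_aeval, ← Set.range_comp]
    rfl
  exact ⟨fun a => isAlgebraic_algebraMap
    (⟨a, hs ▸ trivial⟩ : Algebra.adjoin K (Set.range (generator f)))⟩

theorem card_le_algRank [Finite σ] {κ : Type} [Fintype κ] (f : ι → MvPolynomial σ K)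
    {s : κ → ι} (h : AlgebraicIndependent K (f ∘ s)) : Fintype.card κ ≤ algRank f := by
  have hg : AlgebraicIndependent K (generator f ∘ s) :=
    AlgebraicIndependent.of_comp (generatedAlgebra f).val h
  have := hg.cardinalMk_le_trdeg
  rw [trdeg_generatedAlgebra] at this
  simpa using this

theorem rank_jacobianAt_le [CharZero K] [Fintype ι] [Fintype σ] (f : ι → MvPolynomial σ K)
    (x : σ → K) : (jacobianAt f x).rank ≤ algRank f := by
  classical
  obtain ⟨r, hr, -, hli⟩ := Submodule.exists_fun_fin_finrank_span_eq K
    (Set.range (jacobianAt f x).row)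
  rw [Matrix.rank_eq_finrank_span_row]
  choose s hs using hr
  have h : LinearIndependent K (jacobianAt (f ∘ s) x).row := by
    have : (jacobianAt (f ∘ s) x).row = r := _root_.funext hs
    rwa [this]
  simpa using card_le_algRank f (algebraicIndependent_of_linearIndependent_jacobianAt h)

/-- A transcendence basis chosen among the generators has independent rows off a proper closed set.
The factor `G` lets the point also avoid a given hypersurface. -/
theorem exists_algRank_le_rank_jacobianAt [CharZero K] [Fintype ι] [Fintype σ]
    (f : ι → MvPolynomial σ K) {G : MvPolynomial σ K} (hG : G ≠ 0) :
    ∃ x, eval x G ≠ 0 ∧ algRank f ≤ (jacobianAt f x).rank := by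
  classical
  obtain ⟨t, hts, ht⟩ := exists_isTranscendenceBasis_subset (R := K) (Set.range (generator f))
  have hcard : Cardinal.mk t = algRank f := by
    rw [ht.cardinalMk_eq_trdeg, trdeg_generatedAlgebra]
  have htf : t.Finite := (Set.finite_range _).subset hts
  have := htf.fintype
  have hind := ht.1.map' (f := (generatedAlgebra f).val) Subtype.val_injective
  obtain ⟨δ, hδ, H⟩ := exists_linearIndependent_jacobianAt_of_algebraicIndependent hind
  obtain ⟨x, hx⟩ : ∃ x, eval x (G * δ) ≠ 0 := by
    by_contra! h
    exact mul_ne_zero hG hδ (MvPolynomial.funext fun x => by rw [h x, map_zero])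
  rw [map_mul] at hx
  refine ⟨x, left_ne_zero_of_mul hx, ?_⟩
  have hli := H x (right_ne_zero_of_mul hx)
  choose i hi using fun y : t => hts y.2
  have h1 : LinearIndependent K ((jacobianAt f x).row ∘ i) := by
    convert hli using 1
    ext1 a
    have hfa : f (i a) = (a : generatedAlgebra f) := congrArg Subtype.val (hi a)
    ext1 j
    change eval x (pderiv j (f (i a))) = _
    rw [hfa]
    rfl
  rw [Matrix.rank_eq_finrank_span_row]
  have h3 : Fintype.card t = algRank f := by simpa using hcard
  rw [← h3, ← finrank_span_eq_card h1]
  exact Submodule.finrank_mono (Submodule.span_mono (Set.range_comp_subset_range _ _))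

end MvPolynomial

/-! ### The polar defect as a transcendence degree -/

theorem MvPolynomial.IsHomogeneous.eval_smul {σ K : Type*} [Fintype σ] [CommRing K] {n : ℕ}
    {p : MvPolynomial σ K} (hp : p.IsHomogeneous n) (c : K) (x : σ → K) :
    eval (c • x) p = c ^ n * eval x p := by
  rw [eval_eq', eval_eq', Finset.mul_sum]
  refine Finset.sum_congr rfl fun m hm => ?_
  have h : ∑ i, m i = n := by
    have := hp (mem_support_iff.1 hm)
    rwa [Finsupp.weight_apply, Finsupp.sum_fintype _ _ (by simp), Finset.sum_congr rfl] at this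
    simp
  simp only [Pi.smul_apply, smul_eq_mul, mul_pow, Finset.prod_mul_distrib]
  rw [Finset.prod_pow_eq_pow_sum, h]
  ring

theorem AlgHom.ringKrullDim_quotient_ker {k A B : Type*} [CommRing k] [CommRing A] [CommRing B]
    [Algebra k A] [Algebra k B] (φ : A →ₐ[k] B) :
    ringKrullDim (A ⧸ RingHom.ker φ) = ringKrullDim φ.range :=
  ringKrullDim_eq_of_ringEquiv (Ideal.quotientKerEquivRange φ).toRingEquiv

theorem MvPolynomial.ringKrullDim_quotient_ker_aeval {K σ ι : Type} [Field K] [Finite ι]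
    (f : ι → MvPolynomial σ K) :
    ringKrullDim (MvPolynomial ι K ⧸
      RingHom.ker (aeval f : MvPolynomial ι K →ₐ[K] MvPolynomial σ K)) = (algRank f : ℕ) := by
  have : Algebra.FiniteType K (generatedAlgebra f) :=
    Algebra.FiniteType.of_surjective (AlgHom.rangeRestrict (aeval f))
      (AlgHom.rangeRestrict_surjective _)
  rw [algRank, ← ringKrullDim_eq_trdeg, AlgHom.ringKrullDim_quotient_ker]

theorem MvPolynomial.algRank_le_card {K σ ι : Type} [Field K] [Finite σ] [Fintype ι]
    (f : ι → MvPolynomial σ K) : algRank f ≤ Fintype.card ι := by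
  have h := lift_trdeg_le_of_surjective
    (AlgHom.rangeRestrict (aeval f : MvPolynomial ι K →ₐ[K] MvPolynomial σ K))
    (AlgHom.rangeRestrict_surjective _)
  rw [trdeg_generatedAlgebra, trdeg_of_isDomain] at h
  simpa using h

theorem MvPolynomial.ker_aeval_eq_bot_of_algRank_eq_card {K σ ι : Type} [Field K] [Finite σ]
    [Fintype ι] {f : ι → MvPolynomial σ K} (h : algRank f = Fintype.card ι) :
    RingHom.ker (aeval f : MvPolynomial ι K →ₐ[K] MvPolynomial σ K) = ⊥ := by
  have hg := Algebra.IsAlgebraic.isTranscendenceBasis_of_le_trdeg_of_finite K (generator f) (by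
    rw [trdeg_generatedAlgebra, h]; simp)
  have hf := hg.1.map' (f := (generatedAlgebra f).val) Subtype.val_injective
  exact (RingHom.injective_iff_ker_eq_bot _).1 hf

namespace PolarDefect

theorem affineCone_mono {n : ℕ} {S T : Set (ℙ ℂ (Fin n → ℂ))} (h : S ⊆ T) :
    affineCone S ⊆ affineCone T := fun _ hv h0 => h (hv h0)

theorem zero_mem_affineCone {n : ℕ} (S : Set (ℙ ℂ (Fin n → ℂ))) : 0 ∈ affineCone S :=
  fun h => (h rfl).elim

theorem subset_zariskiClosure {n : ℕ} (S : Set (ℙ ℂ (Fin n → ℂ))) : S ⊆ zariskiClosure S :=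
  fun _ hp => (affineCone_mono (Set.singleton_subset_iff.2 hp)).trans
    (MvPolynomial.zeroLocus_vanishingIdeal_le _)

theorem homogeneousIdeal_zariskiClosure {n : ℕ} (S : Set (ℙ ℂ (Fin n → ℂ))) :
    homogeneousIdeal (zariskiClosure S) = homogeneousIdeal S := by
  refine le_antisymm
    (MvPolynomial.vanishingIdeal_anti_mono (affineCone_mono (subset_zariskiClosure S)))
    fun f hf v hv => ?_
  by_cases h0 : v = 0
  · exact hf v (h0 ▸ zero_mem_affineCone S)
  · exact hv h0 (fun _ => rfl) f hf

/-- The partial derivatives of a polynomial. -/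
def partials {n : ℕ} (F : MvPolynomial (Fin n) ℂ) : Fin n → MvPolynomial (Fin n) ℂ :=
  fun i => pderiv i F

/-- The transcendence degree of the algebra generated by the partial derivatives. -/
def polarRank {n : ℕ} (F : MvPolynomial (Fin n) ℂ) : ℕ :=
  algRank (partials F)

theorem grad_smul {n d : ℕ} {F : MvPolynomial (Fin n) ℂ} (hF : F.IsHomogeneous d) (c : ℂ)
    (v : Fin n → ℂ) : grad F (c • v) = c ^ (d - 1) • grad F v :=
  _root_.funext fun _ => hF.pderiv.eval_smul c v

theorem aeval_grad {n : ℕ} (F : MvPolynomial (Fin n) ℂ) (v : Fin n → ℂ)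
    (p : MvPolynomial (Fin n) ℂ) : aeval (grad F v) p = eval v (aeval (partials F) p) := by
  have h : aeval (grad F v) = (aeval v).comp (aeval (partials F)) := by
    ext i
    simp [grad, partials, aeval_eq_eval]
  rw [h, AlgHom.comp_apply, aeval_eq_eval]

theorem homogeneousIdeal_polarImage {n d : ℕ} (hd : 1 < d) {F : MvPolynomial (Fin n) ℂ}
    (hF : F.IsHomogeneous d) : homogeneousIdeal (polarImage F) =
      RingHom.ker (aeval (partials F) : MvPolynomial (Fin n) ℂ →ₐ[ℂ] MvPolynomial (Fin n) ℂ) := by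
  have hd' : d - 1 ≠ 0 := by omega
  -- Since d > 1, the origin is a value of the gradient, and a nonzero gradient forces v ≠ 0.
  have h0 : grad F 0 = 0 := by
    simpa [hd'] using grad_smul hF 0 0
  rw [polarImage, homogeneousIdeal_zariskiClosure]
  ext p
  rw [RingHom.mem_ker]
  constructor
  · intro hp
    refine MvPolynomial.funext fun v => ?_
    rw [← aeval_grad, map_zero]
    refine hp _ fun hv => ⟨v, ?_, hv, rfl⟩
    rintro rfl
    exact hv h0
  · intro hp w hw
    have key : ∀ v, aeval (grad F v) p = 0 := fun v => by rw [aeval_grad, hp, map_zero]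
    by_cases hw0 : w = 0
    · rw [hw0, ← h0, key]
    · obtain ⟨v, -, hv, hwv⟩ := hw hw0
      obtain ⟨c, hc⟩ := (Projectivization.mk_eq_mk_iff' ℂ _ _ hw0 hv).1 hwv
      -- The gradient has degree d - 1, so a root of that order moves the scalar into the argument:
      -- the gradient values fill their own cone.
      obtain ⟨μ, hμ⟩ := IsAlgClosed.exists_pow_nat_eq c (Nat.pos_of_ne_zero hd')
      rw [← hc, ← hμ, ← grad_smul hF, key]

theorem projDim_polarImage {n d : ℕ} (hd : 1 < d) {F : MvPolynomial (Fin n) ℂ}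
    (hF : F.IsHomogeneous d) : projDim (polarImage F) = polarRank F - 1 := by
  rw [projDim, homogeneousIdeal_polarImage hd hF, ringKrullDim_quotient_ker_aeval]
  rfl

theorem pdef_eq {n d : ℕ} (hd : 1 < d) {F : MvPolynomial (Fin n) ℂ} (hF : F.IsHomogeneous d) :
    pdef F = n - polarRank F := by
  rw [pdef, projDim_polarImage hd hF]
  ring

theorem isPolarDefective_iff {n d : ℕ} (hd : 1 < d) {F : MvPolynomial (Fin n) ℂ}
    (hF : F.IsHomogeneous d) : IsPolarDefective F ↔ polarRank F < n := by
  have hle : polarRank F ≤ n := (algRank_le_card (partials F)).trans_eq (Fintype.card_fin n)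
  rw [IsPolarDefective, lt_iff_le_and_ne, and_iff_right hle, not_iff_not]
  constructor
  · intro h
    have h1 := projDim_polarImage hd hF
    have h2 : homogeneousIdeal (Set.univ : Set (ℙ ℂ (Fin n → ℂ))) = ⊥ := by
      refine eq_bot_iff.2 fun p hp => MvPolynomial.funext fun v => ?_
      rw [map_zero, ← aeval_eq_eval]
      exact hp v fun _ => trivial
    rw [h, projDim, h2, ringKrullDim_eq_of_ringEquiv (RingEquiv.quotientBot _),
      MvPolynomial.ringKrullDim_of_isNoetherianRing, ringKrullDim_eq_zero_of_field, zero_add,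
      Nat.card_fin] at h1
    change (n : ℤ) - 1 = _ at h1
    omega
  · intro h
    have h1 : homogeneousIdeal (polarImage F) = ⊥ := by
      rw [homogeneousIdeal_polarImage hd hF]
      exact ker_aeval_eq_bot_of_algRank_eq_card (h.trans (Fintype.card_fin n).symm)
    rw [polarImage, homogeneousIdeal_zariskiClosure] at h1
    refine Set.eq_univ_of_forall fun p => ?_
    change _ ⊆ MvPolynomial.zeroLocus ℂ (homogeneousIdeal _)
    rw [h1, MvPolynomial.zeroLocus_bot]
    exact Set.subset_univ _

end PolarDefect

/-! ### Quadratic forms restricted to a hyperplane -/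

/-- A symmetric matrix that is nonzero on a vector `x` remains of the maximal possible rank on a
suitable hyperplane through `x`: there are many orthogonal anisotropic vectors in it. -/
theorem Matrix.IsSymm.exists_hyperplane {K : Type*} [Field K] [Invertible (2 : K)] {N s : ℕ}
    {B : Matrix (Fin (N + 1)) (Fin (N + 1)) K} (hB : B.IsSymm) {x : Fin (N + 1) → K}
    (hx : x ⬝ᵥ B.mulVec x ≠ 0) (hsr : s ≤ B.rank) (hsN : s ≤ N) (hN : 0 < N) :
    ∃ a : Fin (N + 1) → K, a ≠ 0 ∧ a ⬝ᵥ x = 0 ∧ ∃ w : Fin s → Fin (N + 1) → K,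
      (∀ i, a ⬝ᵥ w i = 0) ∧ (∀ i j, i ≠ j → w i ⬝ᵥ B.mulVec (w j) = 0) ∧
      ∀ i, w i ⬝ᵥ B.mulVec (w i) ≠ 0 := by
  classical
  let β : LinearMap.BilinForm K (Fin (N + 1) → K) := Matrix.toBilin' B
  have hβ : ∀ u v, β u v = u ⬝ᵥ B.mulVec v := fun u v => Matrix.toBilin'_apply' B u v
  have hsymm : β.IsSymm := ⟨fun u v => by
    rw [hβ, hβ, Matrix.dotProduct_mulVec, ← Matrix.mulVec_transpose, hB.eq,
      dotProduct_comm]⟩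
  have hβx : β x x ≠ 0 := by rwa [hβ]
  let W := β.orthogonal (Submodule.span K {x})
  have hcompl : IsCompl (Submodule.span K {x}) W :=
    LinearMap.BilinForm.isCompl_span_singleton_orthogonal hβx
  have hx0 : x ≠ 0 := by rintro rfl; simp at hx
  have hWdim : Module.finrank K W = N := by
    have h1 := Submodule.finrank_add_eq_of_isCompl hcompl
    rw [finrank_span_singleton hx0, Module.finrank_fin_fun] at h1
    omega
  obtain ⟨v, hv⟩ := LinearMap.BilinForm.exists_orthogonal_basis (B := β.restrict W)
    ⟨fun u w => hsymm.eq u w⟩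
  let b : Option (Fin (Module.finrank K W)) → Fin (N + 1) → K := fun o => o.elim x fun i => v i
  have hxv : ∀ i, β x (v i) = 0 := fun i => (v i).2 x (Submodule.mem_span_singleton_self x)
  have horth : ∀ i j, i ≠ j → β (b i) (b j) = 0 := by
    rintro (_ | i) (_ | j) hij
    · exact (hij rfl).elim
    · exact hxv j
    · change β (v i) x = 0
      rw [← hsymm.eq]; exact hxv i
    · exact hv fun h => hij (congrArg some h)
  have hspan : Submodule.span K (Set.range b) = ⊤ := by
    rw [eq_top_iff, ← hcompl.sup_eq_top, sup_le_iff]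
    constructor
    · exact Submodule.span_mono (Set.singleton_subset_iff.2 ⟨none, rfl⟩)
    · have h1 : W = Submodule.map W.subtype (Submodule.span K (Set.range v)) := by
        rw [v.span_eq, Submodule.map_top, Submodule.range_subtype]
      refine h1.trans_le ?_
      rw [Submodule.map_span, ← Set.range_comp]
      refine Submodule.span_mono ?_
      rintro _ ⟨i, rfl⟩
      exact ⟨some i, rfl⟩
  let T := Finset.univ.filter fun i => β (b i) (b i) ≠ 0
  -- An isotropic vector of an orthogonal basis is orthogonal to the whole space, so it lies in the
  -- radical.
  have hT0 : ∀ i, i ∉ T → B.mulVec (b i) = 0 := by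
    intro i hi
    have hi : β (b i) (b i) = 0 := by simpa [T] using hi
    have h1 : β (b i) = 0 := by
      refine LinearMap.ext_on hspan ?_
      rintro _ ⟨j, rfl⟩
      rw [LinearMap.zero_apply]
      by_cases hij : i = j
      · rw [← hij, hi]
      · exact horth i j hij
    refine dotProduct_eq_zero _ fun u => ?_
    rw [dotProduct_comm, ← hβ, ← hsymm.eq]
    exact LinearMap.congr_fun h1 u
  have hrank : B.rank ≤ T.card := by
    have h1 : B.mulVecLin.range ≤
        Submodule.span K ((T.image fun i => B.mulVec (b i) : Finset _) : Set _) := by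
      rw [LinearMap.range_eq_map, ← hspan, Submodule.map_span, Submodule.span_le]
      rintro _ ⟨_, ⟨i, rfl⟩, rfl⟩
      by_cases hi : i ∈ T
      · exact Submodule.subset_span (Finset.mem_coe.2 (Finset.mem_image_of_mem _ hi))
      · rw [Matrix.mulVecLin_apply, hT0 i hi]
        exact Submodule.zero_mem _
    exact (Submodule.finrank_mono h1).trans
      ((finrank_span_finset_le_card _).trans Finset.card_image_le)
  -- The basis vector to drop: one in the radical if there is any, which costs no rank; otherwise
  -- the form is nondegenerate, and dropping any vector but `x` leaves N anisotropic ones.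
  obtain ⟨k, hk0, hk⟩ : ∃ k, k ≠ none ∧ s ≤ (T.erase k).card := by
    by_cases h : ∃ k, k ≠ none ∧ k ∉ T
    · obtain ⟨k, hk0, hk⟩ := h
      exact ⟨k, hk0, by rw [Finset.erase_eq_of_notMem hk]; exact hsr.trans hrank⟩
    · push Not at h
      have hTu : T = Finset.univ := by
        refine Finset.eq_univ_iff_forall.2 fun i => ?_
        by_cases hi : i = none
        · rw [hi]; simpa [T, b] using hβx
        · exact h i hi
      refine ⟨some ⟨0, by omega⟩, by simp, ?_⟩
      rw [hTu, Finset.card_erase_of_mem (Finset.mem_univ _), Finset.card_univ, Fintype.card_option,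
        Fintype.card_fin, hWdim]
      exact hsN
  -- The equation `a` of the hyperplane spanned by the remaining N vectors is a nonzero solution of
  -- N linear conditions in N + 1 unknowns.
  let φ : (Fin (N + 1) → K) →ₗ[K] ({j // j ≠ k} → K) :=
    (Matrix.of fun (j : {j // j ≠ k}) => b j).mulVecLin
  have hφ : φ.ker ≠ ⊥ := by
    apply LinearMap.ker_ne_bot_of_finrank_lt
    rw [Module.finrank_fintype_fun_eq_card, Module.finrank_fintype_fun_eq_card]
    simp [Fintype.card_subtype_compl, hWdim]
  obtain ⟨a, ha, ha0⟩ := Submodule.exists_mem_ne_zero_of_ne_bot hφ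
  have hab : ∀ j, j ≠ k → a ⬝ᵥ b j = 0 := fun j hj => by
    rw [dotProduct_comm]
    exact congrFun (LinearMap.mem_ker.1 ha) ⟨j, hj⟩
  let ι : Fin s → Option (Fin (Module.finrank K W)) := fun i =>
    ((T.erase k).equivFin.symm (Fin.castLE hk i) : T.erase k)
  have hι : Function.Injective ι := fun i j h => by
    simpa [ι] using h
  have hιT : ∀ i, ι i ∈ T.erase k := fun i => Subtype.prop _
  refine ⟨a, ha0, hab none hk0.symm, fun i => b (ι i),
    fun i => hab _ (Finset.ne_of_mem_erase (hιT i)), fun i j hij => ?_, fun i => ?_⟩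
  · rw [← hβ]; exact horth _ _ (hι.ne hij)
  · rw [← hβ]
    exact (Finset.mem_filter.1 (Finset.mem_of_mem_erase (hιT i))).2

/-! ### The Hessian and its restriction -/

theorem MvPolynomial.pderiv_pderiv_comm {σ R : Type*} [CommSemiring R] (i j : σ)
    (p : MvPolynomial σ R) : pderiv i (pderiv j p) = pderiv j (pderiv i p) := by
  classical
  ext m
  rcases eq_or_ne i j with rfl | h
  · rfl
  · simp only [coeff_pderiv, Finsupp.add_apply, Finsupp.single_eq_of_ne h,
      Finsupp.single_eq_of_ne h.symm, add_zero]
    rw [add_right_comm]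
    ring

namespace PolarDefect

/-- The Hessian matrix of `F` at `x`. -/
def hessian {n : ℕ} (F : MvPolynomial (Fin n) ℂ) (x : Fin n → ℂ) : Matrix (Fin n) (Fin n) ℂ :=
  jacobianAt (partials F) x

theorem hessian_apply {n : ℕ} (F : MvPolynomial (Fin n) ℂ) (x : Fin n → ℂ) (i j : Fin n) :
    hessian F x i j = eval x (pderiv j (pderiv i F)) := rfl

theorem isSymm_hessian {n : ℕ} (F : MvPolynomial (Fin n) ℂ) (x : Fin n → ℂ) :
    (hessian F x).IsSymm := by
  ext i j
  rw [Matrix.transpose_apply, hessian_apply, hessian_apply, pderiv_pderiv_comm]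

theorem rank_hessian_le {n : ℕ} (F : MvPolynomial (Fin n) ℂ) (x : Fin n → ℂ) :
    (hessian F x).rank ≤ polarRank F :=
  rank_jacobianAt_le _ _

theorem hessian_smul {n d : ℕ} {F : MvPolynomial (Fin n) ℂ} (hF : F.IsHomogeneous d) (c : ℂ)
    (x : Fin n → ℂ) : hessian F (c • x) = c ^ (d - 1 - 1) • hessian F x := by
  ext i j
  exact hF.pderiv.pderiv.eval_smul c x

/-- Euler's formula, once for the partial derivatives and once for `F`. It makes `x` anisotropic as
soon as F(x) ≠ 0. -/
theorem dotProduct_hessian_mulVec_self {n d : ℕ} {F : MvPolynomial (Fin n) ℂ}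
    (hF : F.IsHomogeneous d) (x : Fin n → ℂ) :
    x ⬝ᵥ (hessian F x).mulVec x = d * ((d - 1 : ℕ) * eval x F) := by
  have h1 : (hessian F x).mulVec x = ((d - 1 : ℕ) : ℂ) • grad F x := by
    ext i
    have := congrArg (eval x) (hF.pderiv (i := i)).sum_X_mul_pderiv
    simp only [map_sum, map_mul, eval_X, map_nsmul] at this
    simp only [Matrix.mulVec, dotProduct, hessian_apply, Pi.smul_apply, grad]
    rw [← Nat.cast_smul_eq_nsmul ℂ] at this
    rw [← this]
    exact Finset.sum_congr rfl fun j _ => mul_comm _ _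
  have h2 := congrArg (eval x) hF.sum_X_mul_pderiv
  simp only [map_sum, map_mul, eval_X, map_nsmul] at h2
  rw [h1, dotProduct_smul, dotProduct]
  simp only [grad]
  rw [h2, nsmul_eq_mul, smul_eq_mul]
  ring

/-- The matrix of linear coordinates on a subspace. -/
def coordMatrix {m n : ℕ} {W : Submodule ℂ (Fin n → ℂ)} (e : (Fin m → ℂ) ≃ₗ[ℂ] W) :
    Matrix (Fin n) (Fin m) ℂ :=
  Matrix.of fun i j => (e (Pi.single j 1) : Fin n → ℂ) i

theorem coordMatrix_mulVec {m n : ℕ} {W : Submodule ℂ (Fin n → ℂ)} (e : (Fin m → ℂ) ≃ₗ[ℂ] W)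
    (t : Fin m → ℂ) : (coordMatrix e).mulVec t = e t := by
  have h : (W.subtype ∘ₗ e.toLinearMap) = (coordMatrix e).mulVecLin := by
    refine LinearMap.pi_ext' fun j => LinearMap.ext_ring ?_
    ext i
    simp [coordMatrix]
  exact (LinearMap.congr_fun h t).symm

theorem restrict_eq_aeval {m n : ℕ} (F : MvPolynomial (Fin n) ℂ) {W : Submodule ℂ (Fin n → ℂ)}
    (e : (Fin m → ℂ) ≃ₗ[ℂ] W) :
    restrict F e = aeval (fun i => ∑ j, C (coordMatrix e i j) * X j) F := rfl

theorem isHomogeneous_restrict {m n d : ℕ} {F : MvPolynomial (Fin n) ℂ} (hF : F.IsHomogeneous d)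
    {W : Submodule ℂ (Fin n → ℂ)} (e : (Fin m → ℂ) ≃ₗ[ℂ] W) :
    (restrict F e).IsHomogeneous d := by
  rw [restrict_eq_aeval, ← one_mul d]
  refine hF.aeval _ fun i => IsHomogeneous.sum _ _ _ fun j _ => ?_
  rw [← zero_add 1]
  exact (isHomogeneous_C _ _).mul (isHomogeneous_X _ _)

theorem hessian_restrict {m n : ℕ} (F : MvPolynomial (Fin n) ℂ) {W : Submodule ℂ (Fin n → ℂ)}
    (e : (Fin m → ℂ) ≃ₗ[ℂ] W) (t : Fin m → ℂ) :
    hessian (restrict F e) t =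
      (coordMatrix e).transpose * hessian F (e t) * coordMatrix e := by
  have hg : ∀ i l, pderiv l (∑ j, C (coordMatrix e i j) * X j : MvPolynomial (Fin m) ℂ) =
      C (coordMatrix e i l) := by
    intro i l
    simp [pderiv_X, Pi.single_apply]
  have hev : ∀ p, eval t (aeval (fun i => ∑ j, C (coordMatrix e i j) * X j) p) =
      eval (e t : Fin n → ℂ) p := by
    intro p
    rw [← coordMatrix_mulVec, ← aeval_eq_eval, ← AlgHom.comp_apply, ← aeval_eq_eval]
    congr 1
    ext i
    simp [Matrix.mulVec, dotProduct, aeval_eq_eval]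
  ext j l
  rw [hessian_apply, restrict_eq_aeval, pderiv_aeval]
  simp only [hg, map_sum, pderiv_mul, pderiv_aeval, pderiv_C, mul_zero, add_zero, map_mul, hev,
    eval_C, Matrix.mul_apply, Matrix.transpose_apply, hessian_apply, Finset.sum_mul]
  rw [Finset.sum_comm]
  exact Finset.sum_congr rfl fun _ _ => Finset.sum_congr rfl fun _ _ => by ring

theorem polarRank_restrict_le {m n : ℕ} (F : MvPolynomial (Fin n) ℂ)
    {W : Submodule ℂ (Fin n → ℂ)} (e : (Fin m → ℂ) ≃ₗ[ℂ] W) :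
    polarRank (restrict F e) ≤ min (polarRank F) m := by
  obtain ⟨t, -, ht⟩ := exists_algRank_le_rank_jacobianAt (partials (restrict F e))
    (one_ne_zero (α := MvPolynomial (Fin m) ℂ))
  change polarRank _ ≤ (hessian _ t).rank at ht
  refine le_min (ht.trans ?_) (ht.trans (Matrix.rank_le_width _))
  rw [hessian_restrict]
  exact (Matrix.rank_mul_le_left _ _).trans
    ((Matrix.rank_mul_le_right _ _).trans (rank_hessian_le F _))

/-! ### The open set of good hyperplanes -/

/-- A polynomial that vanishes at the origin and whose nonvanishing is invariant under scaling
defines a Zariski open set. -/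
theorem isZariskiOpen_setOf_eval_rep_ne_zero {n : ℕ} {g : MvPolynomial (Fin n) ℂ}
    (h0 : eval 0 g = 0) (hg : ∀ c : ℂ, c ≠ 0 → ∀ v, eval v g = 0 → eval (c • v) g = 0) :
    IsZariskiOpen {L : ℙ ℂ (Fin n → ℂ) | eval L.rep g ≠ 0} := by
  refine Set.Subset.antisymm (fun p hp => ?_) (subset_zariskiClosure _)
  have hmem : p.rep ∈ affineCone {p} := fun h => p.mk_rep
  have hI : g ∈ homogeneousIdeal {L : ℙ ℂ (Fin n → ℂ) | eval L.rep g ≠ 0}ᶜ := by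
    intro v hv
    rw [aeval_eq_eval]
    by_cases hv0 : v = 0
    · rwa [hv0]
    · have h1 : eval (Projectivization.mk ℂ v hv0).rep g = 0 := by
        simpa using hv hv0
      obtain ⟨c, hc⟩ := Projectivization.exists_smul_eq_mk_rep ℂ v hv0
      have h2 := hg (↑c⁻¹ : ℂ) (Units.ne_zero _) _ h1
      rw [← hc] at h2
      simpa [Units.smul_def, smul_smul] using h2
  have := hp hmem g hI
  rw [aeval_eq_eval] at this
  simpa using this

/-- For `c` with `a ⬝ᵥ c = 1` this is a linear projection onto the hyperplane defined by `a`; it is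
scaled in such a way that it is linear in `a`, and maps to the hyperplane for every `c`. -/
def proj {n : ℕ} (c a v : Fin n → ℂ) : Fin n → ℂ :=
  (a ⬝ᵥ c) • v - (a ⬝ᵥ v) • c

theorem dotProduct_proj {n : ℕ} (c a v : Fin n → ℂ) : a ⬝ᵥ proj c a v = 0 := by
  simp [proj, dotProduct_sub, dotProduct_smul, mul_comm]

theorem proj_eq_self {n : ℕ} {c a v : Fin n → ℂ} (hc : a ⬝ᵥ c = 1) (hv : a ⬝ᵥ v = 0) :
    proj c a v = v := by
  simp [proj, hc, hv]

theorem proj_smul {n : ℕ} (c a v : Fin n → ℂ) (r : ℂ) : proj c (r • a) v = r • proj c a v := by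
  simp [proj, smul_dotProduct, smul_sub, smul_smul]

/-- The Gram matrix of the vectors `proj c a (w i)` with respect to the Hessian of `F` at
`proj c a x`. -/
def projGram {n s : ℕ} (F : MvPolynomial (Fin n) ℂ) (c x : Fin n → ℂ) (w : Fin s → Fin n → ℂ)
    (a : Fin n → ℂ) : Matrix (Fin s) (Fin s) ℂ :=
  Matrix.of (fun i => proj c a (w i)) * hessian F (proj c a x) *
    (Matrix.of fun i => proj c a (w i)).transpose

theorem projGram_smul {n s d : ℕ} {F : MvPolynomial (Fin n) ℂ} (hF : F.IsHomogeneous d)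
    (c x : Fin n → ℂ) (w : Fin s → Fin n → ℂ) (r : ℂ) (a : Fin n → ℂ) :
    projGram F c x w (r • a) = (r * r ^ (d - 1 - 1) * r) • projGram F c x w a := by
  have h : (Matrix.of fun i => proj c (r • a) (w i)) =
      r • (Matrix.of fun i => proj c a (w i) : Matrix (Fin s) (Fin n) ℂ) := by
    ext i j
    simp [proj_smul]
  rw [projGram, proj_smul, hessian_smul hF, h, projGram, Matrix.transpose_smul, Matrix.smul_mul,
    Matrix.smul_mul, Matrix.mul_smul, Matrix.mul_smul, Matrix.smul_mul, smul_smul, smul_smul]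
  congr 1
  ring

/-- The factor a · c makes the polynomial vanish at the origin even when `s` = 0 and the determinant
is 1. -/
theorem exists_eval_eq_det_projGram {n s : ℕ} (F : MvPolynomial (Fin n) ℂ) (c x : Fin n → ℂ)
    (w : Fin s → Fin n → ℂ) :
    ∃ g : MvPolynomial (Fin n) ℂ, ∀ a, eval a g = (a ⬝ᵥ c) * (projGram F c x w a).det := by
  let ℓ : (Fin n → ℂ) → MvPolynomial (Fin n) ℂ := fun v => ∑ m, X m * C (v m)
  have hℓ : ∀ a v, eval a (ℓ v) = a ⬝ᵥ v := fun a v => by simp [ℓ, dotProduct]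
  let π : (Fin n → ℂ) → Fin n → MvPolynomial (Fin n) ℂ := fun v k => ℓ c * C (v k) - ℓ v * C (c k)
  have hπ : ∀ a v k, eval a (π v k) = proj c a v k := fun a v k => by simp [π, hℓ, proj]
  let Q : Matrix (Fin s) (Fin n) (MvPolynomial (Fin n) ℂ) := Matrix.of fun i => π (w i)
  let H : Matrix (Fin n) (Fin n) (MvPolynomial (Fin n) ℂ) :=
    Matrix.of fun i j => aeval (π x) (pderiv j (pderiv i F))
  refine ⟨ℓ c * (Q * H * Q.transpose).det, fun a => ?_⟩
  have hQ : Q.map (eval a) = Matrix.of fun i => proj c a (w i) := by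
    ext i j
    simp [Q, hπ]
  have hH : H.map (eval a) = hessian F (proj c a x) := by
    have hev : ∀ p, eval a (aeval (π x) p) = eval (proj c a x) p := by
      intro p
      rw [← aeval_eq_eval, ← AlgHom.comp_apply, ← aeval_eq_eval]
      congr 1
      ext i
      simp [aeval_eq_eval, hπ]
    ext i j
    exact hev _
  rw [map_mul, hℓ, RingHom.map_det, RingHom.mapMatrix_apply, Matrix.map_mul, Matrix.map_mul,
    Matrix.transpose_map, hQ, hH, projGram]

/-- The projected vectors lie in the hyperplane, so their Gram matrix factors through the Hessian of
the restriction, which therefore has rank at least `s`. -/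
theorem le_polarRank_restrict {n m s : ℕ} {F : MvPolynomial (Fin n) ℂ} {c x : Fin n → ℂ}
    {w : Fin s → Fin n → ℂ} {L : ℙ ℂ (Fin n → ℂ)} (h : (projGram F c x w L.rep).det ≠ 0)
    (e : (Fin m → ℂ) ≃ₗ[ℂ] hyperplane L) : s ≤ polarRank (restrict F e) := by
  have hmem : ∀ v, proj c L.rep v ∈ hyperplane L := fun v => dotProduct_proj _ _ _
  let t : Fin m → ℂ := e.symm ⟨_, hmem x⟩
  let R : Matrix (Fin s) (Fin m) ℂ := Matrix.of fun i => e.symm ⟨_, hmem (w i)⟩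
  have hR : R * (coordMatrix e).transpose = Matrix.of fun i => proj c L.rep (w i) := by
    ext i j
    have := congrFun (coordMatrix_mulVec e (R i)) j
    rw [Matrix.mul_apply]
    simp only [Matrix.mulVec, dotProduct] at this
    simp only [Matrix.transpose_apply, mul_comm (R i _), this]
    change (e (e.symm ⟨_, hmem (w i)⟩) : Fin n → ℂ) j = _
    rw [e.apply_symm_apply]
    rfl
  have hgram : projGram F c x w L.rep =
      R * (hessian (restrict F e) t) * R.transpose := by
    rw [hessian_restrict, projGram, ← hR, Matrix.transpose_mul, Matrix.transpose_transpose]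
    simp only [t, LinearEquiv.apply_symm_apply, Matrix.mul_assoc]
  have hrank := Matrix.rank_of_isUnit _ ((Matrix.isUnit_iff_isUnit_det _).2 h.isUnit)
  rw [Fintype.card_fin] at hrank
  rw [← hrank, hgram]
  exact (Matrix.rank_mul_le_left _ _).trans
    ((Matrix.rank_mul_le_right _ _).trans (rank_hessian_le _ _))

theorem exists_det_projGram_ne_zero {N d : ℕ} (hd : 1 < d) {F : MvPolynomial (Fin (N + 1)) ℂ}
    (hF : F.IsHomogeneous d) (hF0 : F ≠ 0) :
    ∃ (c a x : Fin (N + 1) → ℂ) (w : Fin (min (polarRank F) N) → Fin (N + 1) → ℂ),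
      a ⬝ᵥ c = 1 ∧ (projGram F c x w a).det ≠ 0 := by
  have hdual : ∀ a : Fin (N + 1) → ℂ, a ≠ 0 → ∃ c, a ⬝ᵥ c = 1 := by
    intro a ha
    obtain ⟨i, hi⟩ := Function.ne_iff.1 ha
    exact ⟨Pi.single i (a i)⁻¹, by simpa using mul_inv_cancel₀ hi⟩
  rcases Nat.eq_zero_or_pos N with rfl | hN
  -- For N = 0 the Gram matrix is empty, with determinant 1.
  · obtain ⟨c, hc⟩ := hdual 1 one_ne_zero
    have : IsEmpty (Fin (min (polarRank F) 0)) := ⟨fun i => by simpa using i.2⟩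
    exact ⟨c, 1, 0, 0, hc, by rw [Matrix.det_isEmpty]; exact one_ne_zero⟩
  · obtain ⟨x, hx, hrank⟩ := exists_algRank_le_rank_jacobianAt (partials F) hF0
    have hxx : x ⬝ᵥ (hessian F x).mulVec x ≠ 0 := by
      rw [dotProduct_hessian_mulVec_self hF]
      have h1 : (d : ℂ) ≠ 0 := by exact_mod_cast (by omega : d ≠ 0)
      have h2 : ((d - 1 : ℕ) : ℂ) ≠ 0 := by exact_mod_cast (by omega : d - 1 ≠ 0)
      exact mul_ne_zero h1 (mul_ne_zero h2 hx)
    have : Invertible (2 : ℂ) := invertibleOfNonzero two_ne_zero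
    obtain ⟨a, ha, hax, w, haw, horth, hw⟩ := (isSymm_hessian F x).exists_hyperplane hxx
      (s := min (polarRank F) N) ((min_le_left _ _).trans hrank) (min_le_right _ _) hN
    obtain ⟨c, hc⟩ := hdual a ha
    refine ⟨c, a, x, w, hc, ?_⟩
    have hentry : projGram F c x w a =
        Matrix.diagonal fun i => w i ⬝ᵥ (hessian F x).mulVec (w i) := by
      have hP : ∀ i, proj c a (w i) = w i := fun i => proj_eq_self hc (haw i)
      ext i j
      rw [projGram, proj_eq_self hc hax]
      simp only [hP]
      rw [Matrix.mul_assoc, Matrix.mul_apply']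
      change w i ⬝ᵥ (hessian F x).mulVec (w j) = _
      rw [Matrix.diagonal_apply]
      split_ifs with hij
      · rw [hij]
      · exact horth i j hij
    rw [hentry, Matrix.det_diagonal]
    exact Finset.prod_ne_zero_iff.2 fun i _ => hw i

end PolarDefect

end

/-! ### Conclusion -/

theorem proposition2p4 (N d : ℕ) (hd : 1 < d) (F : MvPolynomial (Fin (N + 1)) ℂ)
    (hFd : F.IsHomogeneous d) (hF : Irreducible F) :
    ∃ U : Set (ℙ ℂ (Fin (N + 1) → ℂ)), PolarDefect.IsZariskiOpen U ∧ U.Nonempty ∧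
      ∀ L ∈ U, ∀ e : (Fin N → ℂ) ≃ₗ[ℂ] PolarDefect.hyperplane L,
        ((PolarDefect.pdef F = 0 ∧ PolarDefect.pdef (PolarDefect.restrict F e) = 0) ∨
          PolarDefect.pdef F = PolarDefect.pdef (PolarDefect.restrict F e) + 1) ∧
        (PolarDefect.IsPolarDefective (PolarDefect.restrict F e) →
          PolarDefect.IsPolarDefective F) := by
  obtain ⟨c, a, x, w, hac, hdet⟩ :=
    PolarDefect.exists_det_projGram_ne_zero hd hFd hF.ne_zero
  obtain ⟨g, hg⟩ := PolarDefect.exists_eval_eq_det_projGram F c x w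
  have hzero : ∀ r : ℂ, r ≠ 0 → ∀ v, MvPolynomial.eval v g = 0 →
      MvPolynomial.eval (r • v) g = 0 := by
    intro r _ v hv
    rw [hg, PolarDefect.projGram_smul hFd, Matrix.det_smul, smul_dotProduct, smul_eq_mul]
    rw [hg] at hv
    linear_combination (r * (r * r ^ (d - 1 - 1) * r) ^ Fintype.card (Fin _)) * hv
  refine ⟨{L | MvPolynomial.eval L.rep g ≠ 0},
    PolarDefect.isZariskiOpen_setOf_eval_rep_ne_zero (by rw [hg, zero_dotProduct, zero_mul]) hzero,
    ?_, fun L hL e => ?_⟩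
  · have ha : a ≠ 0 := by
      rintro rfl
      simp at hac
    refine ⟨Projectivization.mk ℂ a ha, fun h => ?_⟩
    obtain ⟨r, hr⟩ := Projectivization.exists_smul_eq_mk_rep ℂ a ha
    have h1 := hzero (↑r⁻¹ : ℂ) (Units.ne_zero _) _ h
    rw [← hr, Units.smul_def, smul_smul, Units.inv_mul, one_smul, hg, hac, one_mul] at h1
    exact hdet h1
  · have hL : MvPolynomial.eval L.rep g ≠ 0 := hL
    rw [hg] at hL
    have hlow := PolarDefect.le_polarRank_restrict (right_ne_zero_of_mul hL) e
    have hup := PolarDefect.polarRank_restrict_le F e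
    have hres := PolarDefect.isHomogeneous_restrict hFd e
    have hle : PolarDefect.polarRank F ≤ N + 1 :=
      (MvPolynomial.algRank_le_card (PolarDefect.partials F)).trans_eq (Fintype.card_fin _)
    rw [PolarDefect.pdef_eq hd hFd, PolarDefect.pdef_eq hd hres,
      PolarDefect.isPolarDefective_iff hd hFd, PolarDefect.isPolarDefective_iff hd hres]
    -- The rank of the restriction is now exactly min(r, N), with r ≤ N + 1: both defects vanish if
    -- r = N + 1, and they differ by one if r ≤ N.
    omega
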